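/- A function system on a topological space $Y$ is a finite non-empty family $\mathcal F$ of continuous maps $Y\to Y$; it acts on the hyperspace $\mathbb K(Y)$ of non-empty compact subsets of $Y$, endowed with the Vietoris topology (for metric $Y$: the topology of the Hausdorff metric), by $\mathcal F(K)=\bigcup_{f\in\mathcal F}f(K)$. A set $A\in\mathbb K(Y)$ is the attractor of $\mathcal F$, written $A_{\mathcal F}$, if $\mathcal F(A)=A$ and $\mathcal F^n(K)\to A$ in $\mathbb K(Y)$ for every $K\in\mathbb K(Y)$. A map $f:Y\to Z$ between metric spaces is a Banach contraction if it is Lipschitz with a constant less than $1$, and a Rakotch contraction if there is a function $\varphi:[0,\infty)\to[0,\infty)$ with $\sup_{a<t<\infty}\varphi(t)/t<1$ for every $a>0$ and $d_Z(f(x),f(x'))\le\varphi(d_Y(x,x'))$ for all $x,x'\in Y$. A non-empty compact metric space $X$ is a Rakotch fractal (respectively, a Banach fractal) if $X=\bigcup_{f\in\mathcal F}f(X)$ for some function system $\mathcal F$ on $X$ consisting of Rakotch (respectively, Banach) contractions. The Urysohn universal space $\mathbb U$ is the separable complete metric space, unique up to bijective isometry, such that every isometric embedding $B\to\mathbb U$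 of a subspace $B$ of a finite metric space $A$ extends to an isometric embedding $A\to\mathbb U$. Theorem. Every Rakotch fractal is isometric to the attractor $A_{\mathcal F}$ of a function system $\mathcal F$ on $\mathbb U$ consisting of Rakotch contractions of $\mathbb U$. Likewise, every Banach fractal is isometric to the attractor $A_{\mathcal F}$ of a function system $\mathcal F$ on $\mathbb U$ consisting of Banach contractions of $\mathbb U$. -/

import Mathlib

open Filter Topology TopologicalSpace
open scoped NNReal

/-- A function system on a topological space: a finite family of continuous self-maps. The family
is non-empty, so that it acts on the hyperspace of non-empty compact sets. -/
structure FunctionSystem (X : Type*) [TopologicalSpace X] where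
  maps : Set C(X, X)
  finite : maps.Finite
  nonempty : maps.Nonempty

namespace FunctionSystem

variable {X : Type*} [TopologicalSpace X]

/-- The self-map `K ↦ ⋃ f ∈ 𝓕, f(K)` of the hyperspace of non-empty compact subsets of `X`. -/
def act (F : FunctionSystem X) (K : NonemptyCompacts X) : NonemptyCompacts X where
  carrier := ⋃ f ∈ F.maps, f '' (K : Set X)
  isCompact' := F.finite.isCompact_biUnion fun f _ => K.isCompact.image f.continuous
  nonempty' := by
    obtain ⟨f, hf⟩ := F.nonempty
    obtain ⟨x, hx⟩ := K.nonempty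
    exact ⟨f x, Set.mem_biUnion hf ⟨x, hx, rfl⟩⟩

/-- `A` is the attractor of `F`: it is fixed by the action of `F`, and for every non-empty compact
set `K` the iterates `F^n(K)` converge to `A` in the Vietoris topology of the hyperspace. -/
def IsAttractor (F : FunctionSystem X) (A : NonemptyCompacts X) : Prop :=
  F.act A = A ∧ ∀ K : NonemptyCompacts X, Tendsto (fun n : ℕ => F.act^[n] K) atTop (𝓝 A)

end FunctionSystem

/-- `f` is `φ`-contracting. -/
def IsPhiContracting {X Y : Type*} [MetricSpace X] [MetricSpace Y] (φ : ℝ≥0 → ℝ≥0)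
    (f : X → Y) : Prop :=
  ∀ x x' : X, nndist (f x) (f x') ≤ φ (nndist x x')

/-- `f` is Rakotch contracting: it is `φ`-contracting for some `φ : [0,∞) → [0,∞)` with
`sup_{a < t < ∞} φ(t)/t < 1` for every `a > 0` (that is, `φ(t)/t` has an upper bound `c < 1` on
`(a,∞)`). -/
def IsRakotchContracting {X Y : Type*} [MetricSpace X] [MetricSpace Y] (f : X → Y) : Prop :=
  ∃ φ : ℝ≥0 → ℝ≥0,
    (∀ a : ℝ≥0, 0 < a → ∃ c : ℝ≥0, c < 1 ∧ ∀ t : ℝ≥0, a < t → φ t / t ≤ c) ∧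
      IsPhiContracting φ f

/-- `f` is Banach contracting: Lipschitz with a constant less than `1`. -/
def IsBanachContracting {X Y : Type*} [MetricSpace X] [MetricSpace Y] (f : X → Y) : Prop :=
  ∃ c : ℝ≥0, c < 1 ∧ LipschitzWith c f

/-- A Rakotch fractal: a non-empty compact metric space that is the union of the images of the
maps of a function system consisting of Rakotch contractions. -/
def IsRakotchFractal (X : Type*) [MetricSpace X] : Prop :=
  CompactSpace X ∧ Nonempty X ∧
    ∃ F : FunctionSystem X, (∀ f ∈ F.maps, IsRakotchContracting f) ∧
      (⋃ f ∈ F.maps, Set.range f) = Set.univ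

/-- A Banach fractal: a non-empty compact metric space that is the union of the images of the
maps of a function system consisting of Banach contractions. -/
def IsBanachFractal (X : Type*) [MetricSpace X] : Prop :=
  CompactSpace X ∧ Nonempty X ∧
    ∃ F : FunctionSystem X, (∀ f ∈ F.maps, IsBanachContracting f) ∧
      (⋃ f ∈ F.maps, Set.range f) = Set.univ

/-- `U` is a universal Urysohn space: a separable complete metric space such that each isometric
embedding into `U` of a subspace `B` of a finite metric space `A` extends to an isometric
embedding of `A`. (Every finite metric space is isometric to one in `Type`.) -/
structure IsUrysohnSpace (U : Type*) [MetricSpace U] : Prop where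
  separable : SeparableSpace U
  complete : CompleteSpace U
  extension : ∀ (A : Type) [MetricSpace A] [Finite A] (B : Set A) (f : B → U), Isometry f →
    ∃ g : A → U, Isometry g ∧ ∀ b : B, g b = f b

/-! ### Katětov functions and their realisation on compact sets. -/

section Urysohn

variable {U : Type*} [MetricSpace U]

/-! Embed the fractal isometrically in the Urysohn space `U` and extend each of its maps, which now
acts on a compact subset, to all of `U` with the same modulus of continuity `ω`. This works for any
monotone subadditive `ω ≤ id`. To add one point `z` to a compact relation `G` with modulus `ω`,
prescribe the distances from its image by `h y = inf (ω (d(z, q.1)) + d(q.2, y))` over `q ∈ G`.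
Subadditivity makes `h` Katětov, and completeness lets a point of `U` realise it on a compact set
(`exists_dist_eq_of_isCompact`). Adding a dense sequence point by point and taking the closure gives
the extension (`exists_extension_of_step`); `ω = id`, with equality of distances, gives the
embedding. A finite family of Rakotch contractions has a common modulus of this kind, the infimum of
suitable lines (`envelope`); for Banach contractions it is linear. The induced action on the
hyperspace has modulus `ω` too, so its iterates converge to the invariant copy of the fractal. -/

/-- A Katětov function: a possible distance function to a point of a metric extension. -/
structure IsKatetov (h : U → ℝ) : Prop where
  le_add_dist : ∀ x y, h x ≤ h y + dist x y
  dist_le_add : ∀ x y, dist x y ≤ h x + h y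

theorem IsKatetov.nonneg {h : U → ℝ} (hh : IsKatetov h) (x : U) : 0 ≤ h x := by
  have := hh.dist_le_add x x
  rw [dist_self] at this
  linarith

/-- The truncation is at most `ε` at `u`, so a point realising it there lies within `ε` of `u`. -/
theorem IsKatetov.min_dist_add {h : U → ℝ} (hh : IsKatetov h) {u : U} {ε : ℝ} (hε : 0 ≤ ε)
    (hu : ∀ y, dist u y ≤ h y + ε) : IsKatetov fun y => min (h y) (dist u y + ε) where
  le_add_dist x y := by
    rw [← min_add_add_right]
    refine min_le_min (hh.le_add_dist x y) ?_
    have := dist_triangle u y x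
    rw [dist_comm y x] at this
    linarith
  dist_le_add x y := by
    have h1 := hh.dist_le_add x y
    have h2 := hu x
    have h3 := hu y
    have h4 := dist_triangle_left x y u
    rcases min_choice (h x) (dist u x + ε) with hx | hx <;>
    rcases min_choice (h y) (dist u y + ε) with hy | hy <;> rw [hx, hy] <;> linarith

/-- The distance of the one-point extension of a metric space prescribed by a function. -/
def optionDist {n : ℕ} (e : Fin n → U) (h : U → ℝ) : Option (Fin n) → Option (Fin n) → ℝ
  | none, none => 0
  | none, some j => h (e j)
  | some i, none => h (e i)
  | some i, some j => dist (e i) (e j)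

/-- The one-point extension of a finite metric space prescribed by a positive Katětov function. -/
abbrev optionMetric {n : ℕ} {e : Fin n → U} (he : Function.Injective e) {h : U → ℝ}
    (hh : IsKatetov h) (hpos : ∀ i, 0 < h (e i)) : MetricSpace (Option (Fin n)) where
  dist := optionDist e h
  dist_self := by rintro (_ | i) <;> simp [optionDist]
  dist_comm := by rintro (_ | i) (_ | j) <;> simp [optionDist, dist_comm]
  dist_triangle := by
    rintro (_ | i) (_ | j) (_ | k) <;> simp only [optionDist]
    · simp
    · simp
    · linarith [hpos j]
    · linarith [hh.le_add_dist (e k) (e j), dist_comm (e k) (e j)]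
    · simp
    · exact hh.dist_le_add _ _
    · linarith [hh.le_add_dist (e i) (e j)]
    · exact dist_triangle _ _ _
  eq_of_dist_eq_zero := by
    rintro (_ | i) (_ | j) hij
    · rfl
    · exact absurd hij (hpos j).ne'
    · exact absurd hij (hpos i).ne'
    · rw [he (dist_eq_zero.1 hij)]

theorem IsUrysohnSpace.nonempty (hU : IsUrysohnSpace U) : Nonempty U := by
  obtain ⟨g, -⟩ := hU.extension Unit ∅ (fun b => b.2.elim) (fun b => b.2.elim)
  exact ⟨g ()⟩

theorem IsUrysohnSpace.exists_dist_eq_of_finite (hU : IsUrysohnSpace U) {h : U → ℝ}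
    (hh : IsKatetov h) {s : Set U} (hs : s.Finite) : ∃ u, ∀ y ∈ s, dist u y = h y := by
  -- A zero of `h` is itself the required point; otherwise the one-point extension is a genuine
  -- metric space.
  by_cases h0 : ∃ y ∈ s, h y = 0
  · obtain ⟨y, -, hy⟩ := h0
    refine ⟨y, fun x _ => ?_⟩
    linarith [hh.dist_le_add y x, hh.le_add_dist x y, dist_comm x y]
  push Not at h0
  obtain ⟨n, e, he, rfl⟩ := hs.fin_param
  have hpos : ∀ i, 0 < h (e i) := fun i =>
    lt_of_le_of_ne (hh.nonneg _) (h0 _ ⟨i, rfl⟩).symm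
  let := optionMetric he hh hpos
  have hval : ∀ b : Set.range (some : Fin n → Option (Fin n)), ∃ i, some i = b.1 := fun b => b.2
  choose k hk using hval
  obtain ⟨g, hg, hgf⟩ := hU.extension (Option (Fin n)) (Set.range some) (fun b => e (k b)) (by
    refine Isometry.of_dist_eq fun b b' => ?_
    rw [Subtype.dist_eq, ← hk b, ← hk b']
    rfl)
  refine ⟨g none, ?_⟩
  rintro _ ⟨i, rfl⟩
  have h1 : g (some i) = e i := by
    have := hgf ⟨some i, i, rfl⟩
    rw [this, Option.some_injective _ (hk ⟨some i, i, rfl⟩)]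
  rw [← h1, hg.dist_eq, h1]
  rfl

/-- One correction step: realise the truncation of `h` at `u` on a finite `δ / 2`-net of `L`
together with `u`. By `hu'` the truncation does not change `h` on `L`, and both `h` and the distance
to `v` are 1-Lipschitz, so the error off the net is at most `δ`. -/
theorem IsUrysohnSpace.exists_approx (hU : IsUrysohnSpace U) {h : U → ℝ} (hh : IsKatetov h)
    {L : Set U} (hL : IsCompact L) {u : U} {ε δ : ℝ} (hε : 0 ≤ ε) (hδ : 0 < δ)
    (hu : ∀ y, dist u y ≤ h y + ε) (hu' : ∀ y ∈ L, h y ≤ dist u y + ε) :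
    ∃ v, dist u v ≤ ε ∧ ∀ y ∈ L, |dist v y - h y| ≤ δ := by
  obtain ⟨t, htL, ht, hcov⟩ := hL.finite_cover_balls (half_pos hδ)
  obtain ⟨v, hv⟩ := hU.exists_dist_eq_of_finite (hh.min_dist_add hε hu) (ht.insert u)
  refine ⟨v, ?_, fun y hy => ?_⟩
  · rw [dist_comm, hv u (Set.mem_insert _ _), dist_self, zero_add]
    exact min_le_right _ _
  · obtain ⟨x, hx, hxy⟩ := Set.mem_iUnion₂.1 (hcov hy)
    have hvx : dist v x = h x := by
      rw [hv x (Set.mem_insert_of_mem _ hx), min_eq_left (hu' x (htL hx))]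
    have := Metric.mem_ball.1 hxy
    have h1 := hh.le_add_dist x y
    have h2 := hh.le_add_dist y x
    have h3 := dist_triangle v x y
    have h4 := dist_triangle v y x
    rw [dist_comm x y] at *
    rw [abs_le]
    constructor <;> linarith

/-- In a Urysohn space, each Katětov function generated by its values on a compact set `L` is
equal on `L` to the distance to some point. -/
theorem IsUrysohnSpace.exists_dist_eq_of_isCompact (hU : IsUrysohnSpace U) {h : U → ℝ}
    (hh : IsKatetov h) {L : Set U} (hL : IsCompact L)
    (hgen : ∀ u ε, (∀ y ∈ L, dist u y ≤ h y + ε) → ∀ y, dist u y ≤ h y + ε) :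
    ∃ u, ∀ y ∈ L, dist u y = h y := by
  have := hU.complete
  obtain ⟨u₀⟩ := hU.nonempty
  -- The error of `u₀` is at most `h u₀`; adding `1` makes all tolerances `C / 2 ^ n` positive.
  set C := h u₀ + 1
  have hC : 0 < C := by linarith [hh.nonneg u₀]
  have hCn : ∀ n : ℕ, 0 < C / 2 ^ n := fun n => by positivity
  let S : ℕ → Set U := fun n => {u | ∀ y ∈ L, |dist u y - h y| ≤ C / 2 ^ n}
  -- Halving the error costs a move of at most the old error, so the moves are summable. Here `hgen`
  -- carries the bound from `L` to all of `U`, as truncation requires.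
  have hstep : ∀ n u, u ∈ S n → ∃ v ∈ S (n + 1), dist u v ≤ C / 2 ^ n := by
    intro n u hu
    obtain ⟨v, hv, hv'⟩ := hU.exists_approx hh hL (hCn n).le (hCn (n + 1))
      (hgen u _ fun y hy => by linarith [(abs_le.1 (hu y hy)).2])
      (fun y hy => by linarith [(abs_le.1 (hu y hy)).1])
    exact ⟨v, hv', hv⟩
  have h0 : u₀ ∈ S 0 := fun y _ => by
    rw [pow_zero, div_one, abs_le]
    constructor <;> linarith [hh.dist_le_add u₀ y, hh.le_add_dist y u₀, dist_comm y u₀]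
  choose! next hnext hdist using hstep
  let u : ℕ → U := fun n => Nat.rec u₀ next n
  have hu : ∀ n, u n ∈ S n := fun n => by
    induction n with
    | zero => exact h0
    | succ n ih => exact hnext n _ ih
  have hcau : CauchySeq u := by
    refine cauchySeq_of_le_geometric_two (C := 2 * C) fun n => ?_
    rw [mul_div_cancel_left₀ _ (two_ne_zero)]
    exact hdist n _ (hu n)
  obtain ⟨w, hw⟩ := cauchySeq_tendsto_of_complete hcau
  refine ⟨w, fun y hy => ?_⟩
  have h1 : Tendsto (fun n => |dist (u n) y - h y|) atTop (𝓝 |dist w y - h y|) :=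
    ((hw.dist tendsto_const_nhds).sub_const _).abs
  have h2 : Tendsto (fun n : ℕ => C / 2 ^ n) atTop (𝓝 0) := by
    simpa [div_eq_mul_inv] using
      (tendsto_pow_atTop_nhds_zero_of_lt_one (r := (2⁻¹ : ℝ)) (by norm_num) (by norm_num)).const_mul C
  have h3 := le_of_tendsto_of_tendsto' h1 h2 fun n => hu n y hy
  linarith [abs_nonpos_iff.1 h3]

end Urysohn

/-! ### Extending compact partial maps one point at a time. -/

section Extension

/-- If each compact relation between `Z` and `U` whose distances are related by `R` can be enlarged
by a pair with any given first coordinate, then it is contained in the graph of a function. -/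
theorem exists_extension_of_step {Z U : Type*} [MetricSpace Z] [MetricSpace U] [SeparableSpace Z]
    [CompleteSpace U] {R : ℝ → ℝ → Prop} (hR : IsClosed {p : ℝ × ℝ | R p.1 p.2})
    (hle : ∀ s t, 0 ≤ s → R s t → t ≤ s) (h0 : R 0 0)
    (hstep : ∀ G : Set (Z × U), IsCompact G → G.Nonempty →
      (∀ p ∈ G, ∀ q ∈ G, R (dist p.1 q.1) (dist p.2 q.2)) →
      ∀ z, ∃ v, ∀ p ∈ G, R (dist z p.1) (dist v p.2))
    {G₀ : Set (Z × U)} (hc : IsCompact G₀) (hne : G₀.Nonempty)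
    (hG₀ : ∀ p ∈ G₀, ∀ q ∈ G₀, R (dist p.1 q.1) (dist p.2 q.2)) :
    ∃ g : Z → U, (∀ x y, R (dist x y) (dist (g x) (g y))) ∧ ∀ p ∈ G₀, g p.1 = p.2 := by
  obtain ⟨p₀, hp₀⟩ := hne
  have : Nonempty Z := ⟨p₀.1⟩
  let Good : Set (Z × U) → Prop := fun G => IsCompact G ∧ G.Nonempty ∧
    ∀ p ∈ G, ∀ q ∈ G, R (dist p.1 q.1) (dist p.2 q.2)
  have hins : ∀ (z : Z) (G : Set (Z × U)), Good G → ∃ v, Good (insert (z, v) G) := by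
    rintro z G ⟨h1, h2, h3⟩
    obtain ⟨v, hv⟩ := hstep G h1 h2 h3 z
    refine ⟨v, h1.insert _, Set.insert_nonempty _ _, ?_⟩
    rintro p (rfl | hp) q (rfl | hq)
    · simpa using h0
    · exact hv q hq
    · rw [dist_comm p.1, dist_comm p.2]
      exact hv p hp
    · exact h3 p hp q hq
  choose v hv using hins
  classical
  -- The `else` branch only makes the recursion total: every `G n` is good.
  let next : Z → Set (Z × U) → Set (Z × U) := fun z G =>
    if h : Good G then insert (z, v z G h) G else G
  let G : ℕ → Set (Z × U) := fun n => Nat.rec G₀ (fun n H => next (denseSeq Z n) H) n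
  have hG : ∀ n, Good (G n) := fun n => by
    induction n with
    | zero => exact ⟨hc, ⟨p₀, hp₀⟩, hG₀⟩
    | succ n ih =>
      change Good (next (denseSeq Z n) (G n))
      rw [show next (denseSeq Z n) (G n) = insert (denseSeq Z n, v _ _ ih) (G n) from dif_pos ih]
      exact hv _ _ ih
  have hsucc : ∀ n, G (n + 1) = insert (denseSeq Z n, v _ _ (hG n)) (G n) := fun n =>
    dif_pos (hG n)
  have hmono : Monotone G := monotone_nat_of_le_succ fun n => by
    rw [hsucc]
    exact Set.subset_insert _ _
  set H := ⋃ n, G n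
  have hH : ∀ p ∈ H, ∀ q ∈ H, R (dist p.1 q.1) (dist p.2 q.2) := by
    intro p hp q hq
    obtain ⟨m, hm⟩ := Set.mem_iUnion.1 hp
    obtain ⟨n, hn⟩ := Set.mem_iUnion.1 hq
    exact (hG (max m n)).2.2 p (hmono (le_max_left _ _) hm) q (hmono (le_max_right _ _) hn)
  have hcl : ∀ p ∈ closure H, ∀ q ∈ closure H, R (dist p.1 q.1) (dist p.2 q.2) := by
    intro p hp q hq
    have hT : IsClosed {r : (Z × U) × (Z × U) | R (dist r.1.1 r.2.1) (dist r.1.2 r.2.2)} :=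
      hR.preimage (f := fun r : (Z × U) × (Z × U) => (dist r.1.1 r.2.1, dist r.1.2 r.2.2))
        (by fun_prop)
    have hsub : H ×ˢ H ⊆ {r : (Z × U) × (Z × U) | R (dist r.1.1 r.2.1) (dist r.1.2 r.2.2)} :=
      fun r hr => hH _ hr.1 _ hr.2
    have hmem : (p, q) ∈ closure (H ×ˢ H) := by
      rw [closure_prod_eq]
      exact ⟨hp, hq⟩
    exact closure_minimal hsub hT hmem
  have hdom : ∀ z, ∃ w, (z, w) ∈ closure H := by
    intro z
    have hd : z ∈ closure (Prod.fst '' H) := by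
      refine closure_mono ?_ (denseRange_denseSeq Z z)
      rintro _ ⟨n, rfl⟩
      refine ⟨(denseSeq Z n, v (denseSeq Z n) _ (hG n)), Set.mem_iUnion.2 ⟨n + 1, ?_⟩, rfl⟩
      rw [hsucc]
      exact Set.mem_insert _ _
    obtain ⟨x, hx, hxz⟩ := mem_closure_iff_seq_limit.1 hd
    choose p hp hpx using hx
    -- By `hle` distances do not grow from first to second coordinates.
    have hcau : CauchySeq fun n => (p n).2 := by
      refine Metric.cauchySeq_iff.2 fun ε hε => ?_
      obtain ⟨N, hN⟩ := Metric.cauchySeq_iff.1 hxz.cauchySeq ε hε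
      refine ⟨N, fun m hm n hn => ?_⟩
      refine (hle _ _ dist_nonneg (hH _ (hp m) _ (hp n))).trans_lt ?_
      rw [hpx, hpx]
      exact hN m hm n hn
    obtain ⟨w, hw⟩ := cauchySeq_tendsto_of_complete hcau
    refine ⟨w, mem_closure_iff_seq_limit.2 ⟨p, hp, ?_⟩⟩
    refine Tendsto.prodMk_nhds ?_ hw
    simpa only [hpx] using hxz
  choose g hg using hdom
  refine ⟨g, fun x y => hcl _ (hg x) _ (hg y), fun p hp => ?_⟩
  -- Two pairs in the closure with equal first coordinates have second coordinates at distance `0`.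
  have := hle _ _ dist_nonneg (hcl _ (hg p.1) p (subset_closure (Set.mem_iUnion.2 ⟨0, hp⟩)))
  rw [dist_self] at this
  exact dist_le_zero.1 this

/-- A monotone subadditive modulus of continuity not exceeding the identity. -/
structure IsShortModulus (ω : ℝ≥0 → ℝ≥0) : Prop where
  mono : Monotone ω
  add_le : ∀ s t, ω (s + t) ≤ ω s + ω t
  le_self : ∀ t, ω t ≤ t

theorem IsShortModulus.id : IsShortModulus id := ⟨monotone_id, fun _ _ => le_rfl, fun _ => le_rfl⟩

theorem IsShortModulus.lipschitzWith {ω : ℝ≥0 → ℝ≥0} (hω : IsShortModulus ω) :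
    LipschitzWith 1 ω := by
  have key : ∀ s t : ℝ≥0, (ω s : ℝ) ≤ ω t + dist s t := by
    intro s t
    have h1 : s ≤ t + nndist s t := by
      rw [← NNReal.coe_le_coe, NNReal.coe_add, coe_nndist, NNReal.dist_eq]
      linarith [le_abs_self ((s : ℝ) - t)]
    have h2 := ((hω.mono h1).trans (hω.add_le _ _)).trans (add_le_add_right (hω.le_self _) _)
    exact_mod_cast h2
  refine LipschitzWith.of_dist_le_mul fun s t => ?_
  rw [NNReal.coe_one, one_mul, NNReal.dist_eq (ω s), abs_le]
  constructor <;> linarith [key s t, key t s, dist_comm s t]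

variable {Z U : Type*} [MetricSpace Z] [MetricSpace U]

/-- In a Urysohn space, a compact relation with a given modulus of continuity can be enlarged. -/
theorem IsUrysohnSpace.exists_dist_eq_iInf (hU : IsUrysohnSpace U) {ω : ℝ≥0 → ℝ≥0}
    (hω : IsShortModulus ω) {G : Set (Z × U)} (hc : IsCompact G) (hne : G.Nonempty)
    (hG : ∀ p ∈ G, ∀ q ∈ G, nndist p.2 q.2 ≤ ω (nndist p.1 q.1)) (z : Z) :
    ∃ v, ∀ p ∈ G, dist v p.2 = ⨅ q : G, ((ω (nndist z q.1.1) : ℝ) + dist q.1.2 p.2) := by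
  have : Nonempty G := hne.to_subtype
  set h : U → ℝ := fun y => ⨅ q : G, ((ω (nndist z q.1.1) : ℝ) + dist q.1.2 y) with hdef
  have hbdd : ∀ y, BddBelow (Set.range fun q : G => (ω (nndist z q.1.1) : ℝ) + dist q.1.2 y) :=
    fun y => ⟨0, by rintro _ ⟨q, rfl⟩; positivity⟩
  have hle : ∀ y (q : G), h y ≤ ω (nndist z q.1.1) + dist q.1.2 y := fun y q => ciInf_le (hbdd y) q
  have hh : IsKatetov h := by
    constructor
    · intro x y
      rw [← sub_le_iff_le_add]
      refine le_ciInf fun q => ?_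
      linarith [hle x q, dist_triangle_right q.1.2 x y]
    · intro x y
      rw [← sub_le_iff_le_add]
      refine le_ciInf fun q => ?_
      rw [sub_le_comm]
      refine le_ciInf fun p => ?_
      -- Subadditivity enters here: it bounds `d(p.2, q.2)` by the sum of the two prescribed radii.
      have h1 : nndist p.1.1 q.1.1 ≤ nndist z p.1.1 + nndist z q.1.1 := nndist_triangle_left _ _ _
      have h2 := (hG p p.2 q q.2).trans ((hω.mono h1).trans (hω.add_le _ _))
      have h3 : dist p.1.2 q.1.2 ≤ ω (nndist z p.1.1) + ω (nndist z q.1.1) := by exact_mod_cast h2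
      linarith [dist_triangle4 x q.1.2 p.1.2 y, dist_comm x q.1.2, dist_comm p.1.2 q.1.2]
  obtain ⟨v, hv⟩ := hU.exists_dist_eq_of_isCompact hh (hc.image continuous_snd) (by
    intro u ε hu y
    rw [← sub_le_iff_le_add]
    refine le_ciInf fun q => ?_
    have h1 := hu q.1.2 ⟨q, q.2, rfl⟩
    have h2 := hle q.1.2 q
    rw [dist_self, add_zero] at h2
    linarith [dist_triangle u q.1.2 y])
  exact ⟨v, fun p hp => hv _ ⟨p, hp, rfl⟩⟩

/-- A Urysohn space contains isometric copies of all separable metric spaces. -/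
theorem IsUrysohnSpace.exists_isometry (hU : IsUrysohnSpace U) [SeparableSpace Z] [Nonempty Z] :
    ∃ g : Z → U, Isometry g := by
  have := hU.complete
  obtain ⟨u₀⟩ := hU.nonempty
  obtain ⟨z₀⟩ := ‹Nonempty Z›
  obtain ⟨g, hg, -⟩ := exists_extension_of_step (Z := Z) (U := U) (R := fun s t => t = s)
    (isClosed_eq continuous_snd continuous_fst) (fun _ _ _ h => h.le) rfl (by
      intro G hc hne hG z
      obtain ⟨v, hv⟩ := hU.exists_dist_eq_iInf IsShortModulus.id hc hne
        (fun p hp q hq => by exact_mod_cast (hG p hp q hq).le) z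
      refine ⟨v, fun p hp => ?_⟩
      rw [hv p hp]
      have : Nonempty G := ⟨⟨p, hp⟩⟩
      -- For `ω = id` and isometric `G`, the triangle inequality shows that the infimum is attained
      -- at `q = p`.
      apply le_antisymm
      · refine (ciInf_le ⟨0, ?_⟩ (⟨p, hp⟩ : G)).trans (by simp)
        rintro _ ⟨q, rfl⟩
        positivity
      · refine le_ciInf fun q => ?_
        rw [hG q q.2 p hp]
        exact dist_triangle _ _ _)
    (isCompact_singleton (x := (z₀, u₀))) (Set.singleton_nonempty _)
    (by rintro _ rfl _ rfl; simp)
  exact ⟨g, Isometry.of_dist_eq hg⟩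

/-- Compact partial maps into a Urysohn space extend with the same modulus of continuity. -/
theorem IsUrysohnSpace.exists_phiContracting_extension (hU : IsUrysohnSpace U) [SeparableSpace Z]
    {ω : ℝ≥0 → ℝ≥0} (hω : IsShortModulus ω) {X : Type*} [TopologicalSpace X] [CompactSpace X]
    [Nonempty X] {i : X → Z} {j : X → U} (hi : Continuous i) (hj : Continuous j)
    (hij : ∀ x x', nndist (j x) (j x') ≤ ω (nndist (i x) (i x'))) :
    ∃ g : Z → U, IsPhiContracting ω g ∧ ∀ x, g (i x) = j x := by
  have := hU.complete
  have hcont : Continuous ω := hω.lipschitzWith.continuous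
  obtain ⟨g, hg, hgi⟩ := exists_extension_of_step (Z := Z) (U := U)
    (R := fun s t => t ≤ ω s.toNNReal) (isClosed_le (by fun_prop) (by fun_prop))
    (fun s t hs h => h.trans ((NNReal.coe_le_coe.2 (hω.le_self _)).trans_eq
      (Real.coe_toNNReal s hs)))
    (NNReal.coe_nonneg _) (by
      intro G hc hne hG z
      obtain ⟨v, hv⟩ := hU.exists_dist_eq_iInf hω hc hne
        (fun p hp q hq => by
          simpa only [dist_nndist, Real.toNNReal_coe, NNReal.coe_le_coe] using hG p hp q hq) z
      refine ⟨v, fun p hp => ?_⟩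
      rw [hv p hp]
      refine (ciInf_le ⟨0, ?_⟩ (⟨p, hp⟩ : G)).trans ?_
      · rintro _ ⟨q, rfl⟩
        positivity
      · rw [dist_self, add_zero, dist_nndist, Real.toNNReal_coe])
    (isCompact_range (hi.prodMk hj)) (Set.range_nonempty _) (by
      rintro _ ⟨x, rfl⟩ _ ⟨x', rfl⟩
      simpa only [dist_nndist, Real.toNNReal_coe, NNReal.coe_le_coe] using hij x x')
  refine ⟨g, fun x y => ?_, fun x => hgi _ ⟨x, rfl⟩⟩
  simpa only [dist_nndist, Real.toNNReal_coe, NNReal.coe_le_coe] using hg x y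

end Extension

/-! ### Convergence of iterates and transfer of the fractal to `U`. -/

section Attractor

/-- A short modulus of continuity that is bounded by a proper fraction of the identity away from
zero. -/
structure IsRakotchModulus (ω : ℝ≥0 → ℝ≥0) : Prop extends IsShortModulus ω where
  exists_le_mul : ∀ a : ℝ≥0, 0 < a → ∃ c : ℝ≥0, c < 1 ∧ ∀ t, a < t → ω t ≤ c * t

theorem IsRakotchModulus.isRakotchContracting {ω : ℝ≥0 → ℝ≥0} (hω : IsRakotchModulus ω)
    {X Y : Type*} [MetricSpace X] [MetricSpace Y] {f : X → Y} (hf : IsPhiContracting ω f) :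
    IsRakotchContracting f := by
  refine ⟨ω, fun a ha => ?_, hf⟩
  obtain ⟨c, hc, h⟩ := hω.exists_le_mul a ha
  exact ⟨c, hc, fun t ht => div_le_of_le_mul₀ zero_le zero_le (h t ht)⟩

/-- The sequence decreases; if it stayed above some `a > 0`, it would decay geometrically with the
ratio valid beyond `a`. -/
theorem IsRakotchModulus.tendsto_zero {ω : ℝ≥0 → ℝ≥0} (hω : IsRakotchModulus ω) {r : ℕ → ℝ≥0}
    (hr : ∀ n, r (n + 1) ≤ ω (r n)) : Tendsto r atTop (𝓝 0) := by
  have hanti : Antitone r := antitone_nat_of_succ_le fun n => (hr n).trans (hω.le_self _)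
  have hex : ∀ a : ℝ≥0, 0 < a → ∃ n, r n ≤ a := by
    intro a ha
    by_contra! hlt
    obtain ⟨c, hc, h⟩ := hω.exists_le_mul a ha
    have hpow : ∀ n, r n ≤ c ^ n * r 0 := fun n => by
      induction n with
      | zero => simp
      | succ n ih =>
        calc r (n + 1) ≤ c * r n := (hr n).trans (h _ (hlt n))
          _ ≤ c * (c ^ n * r 0) := by gcongr
          _ = c ^ (n + 1) * r 0 := by ring
    have hlim : Tendsto (fun n : ℕ => c ^ n * r 0) atTop (𝓝 0) := by
      simpa using (tendsto_pow_atTop_nhds_zero_of_lt_one zero_le hc).mul_const (r 0)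
    obtain ⟨n, hn⟩ := (hlim.eventually (gt_mem_nhds ha)).exists
    exact absurd (hlt n) ((hpow n).trans hn.le).not_gt
  refine tendsto_order.2 ⟨fun a ha => absurd ha not_lt_zero, fun a ha => ?_⟩
  obtain ⟨b, hb, hba⟩ := exists_between ha
  obtain ⟨n, hn⟩ := hex b hb
  exact eventually_atTop.2 ⟨n, fun m hm => ((hanti hm).trans hn).trans_lt hba⟩

variable {U : Type*} [MetricSpace U]

theorem exists_mem_dist_le_dist (K L : NonemptyCompacts U) {x : U} (hx : x ∈ K) :
    ∃ y ∈ L, dist x y ≤ dist K L := by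
  obtain ⟨y, hy, hxy⟩ := L.isCompact.exists_infDist_eq_dist L.nonempty x
  refine ⟨y, hy, ?_⟩
  rw [← hxy, Metric.NonemptyCompacts.dist_eq]
  exact Metric.infDist_le_hausdorffDist_of_mem hx
    (Metric.hausdorffEDist_ne_top_of_nonempty_of_bounded K.nonempty L.nonempty
      K.isCompact.isBounded L.isCompact.isBounded)

/-- A point of `K` has a partner in `L` within the Hausdorff distance, and monotonicity of `ω`
passes this bound on to the images. -/
theorem FunctionSystem.nndist_act_le {ω : ℝ≥0 → ℝ≥0} (hω : Monotone ω) {F : FunctionSystem U}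
    (hF : ∀ f ∈ F.maps, IsPhiContracting ω f) (K L : NonemptyCompacts U) :
    nndist (F.act K) (F.act L) ≤ ω (nndist K L) := by
  have key : ∀ K L : NonemptyCompacts U, ∀ x ∈ F.act K, ∃ y ∈ F.act L,
      dist x y ≤ ω (nndist K L) := by
    intro K L x hx
    obtain ⟨f, hf, a, ha, rfl⟩ := Set.mem_iUnion₂.1 hx
    obtain ⟨b, hb, hab⟩ := exists_mem_dist_le_dist K L ha
    refine ⟨f b, Set.mem_iUnion₂.2 ⟨f, hf, b, hb, rfl⟩, ?_⟩
    exact_mod_cast (hF f hf a b).trans (hω (by exact_mod_cast hab))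
  rw [← NNReal.coe_le_coe, coe_nndist, Metric.NonemptyCompacts.dist_eq]
  refine Metric.hausdorffDist_le_of_mem_dist (NNReal.coe_nonneg _) (key K L) ?_
  rw [nndist_comm]
  exact key L K

theorem FunctionSystem.isAttractor_of_isRakotchModulus {ω : ℝ≥0 → ℝ≥0} (hω : IsRakotchModulus ω)
    {F : FunctionSystem U} (hF : ∀ f ∈ F.maps, IsPhiContracting ω f) {A : NonemptyCompacts U}
    (hA : F.act A = A) : F.IsAttractor A := by
  refine ⟨hA, fun K => ?_⟩
  rw [tendsto_iff_dist_tendsto_zero]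
  have := hω.tendsto_zero (r := fun n => nndist (F.act^[n] K) A) fun n => by
    rw [Function.iterate_succ_apply']
    nth_rewrite 1 [← hA]
    exact F.nndist_act_le hω.mono hF _ _
  simpa only [coe_nndist, NNReal.coe_zero] using NNReal.tendsto_coe.2 this

theorem IsUrysohnSpace.exists_isAttractor (hU : IsUrysohnSpace U) {ω : ℝ≥0 → ℝ≥0}
    (hω : IsRakotchModulus ω) {X : Type*} [MetricSpace X] [CompactSpace X] [Nonempty X]
    {F : FunctionSystem X} (hF : ∀ f ∈ F.maps, IsPhiContracting ω f)
    (hcov : (⋃ f ∈ F.maps, Set.range f) = Set.univ) :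
    ∃ F' : FunctionSystem U, (∀ f ∈ F'.maps, IsPhiContracting ω f) ∧
      ∃ A : NonemptyCompacts U, F'.IsAttractor A ∧ Nonempty (X ≃ᵢ A) := by
  have := hU.separable
  obtain ⟨i, hi⟩ := hU.exists_isometry (Z := X)
  -- Putting membership inside the existential makes `g` a total choice; maps outside the system get
  -- the identity.
  have hext : ∀ f : C(X, X), ∃ g : C(U, U), f ∈ F.maps →
      IsPhiContracting ω g ∧ ∀ x, g (i x) = i (f x) := by
    intro f
    by_cases hf : f ∈ F.maps
    · obtain ⟨g, hg, hgi⟩ := hU.exists_phiContracting_extension hω.toIsShortModulus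
        hi.continuous (hi.continuous.comp f.continuous) (fun x x' => by
          rw [Function.comp_apply, Function.comp_apply, hi.nndist_eq, hi.nndist_eq]
          exact hF f hf x x')
      have hlip : LipschitzWith 1 g := LipschitzWith.of_dist_le_mul fun x y => by
        rw [NNReal.coe_one, one_mul]
        exact_mod_cast (hg x y).trans (hω.le_self _)
      exact ⟨⟨g, hlip.continuous⟩, fun _ => ⟨hg, hgi⟩⟩
    · exact ⟨ContinuousMap.id U, fun h => absurd h hf⟩
  choose g hg using hext
  let F' : FunctionSystem U := ⟨g '' F.maps, F.finite.image g, F.nonempty.image g⟩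
  have hF' : ∀ f ∈ F'.maps, IsPhiContracting ω f := by
    rintro _ ⟨f, hf, rfl⟩
    exact (hg f hf).1
  let A : NonemptyCompacts U := ⟨⟨Set.range i, isCompact_range hi.continuous⟩, Set.range_nonempty i⟩
  refine ⟨F', hF', A, FunctionSystem.isAttractor_of_isRakotchModulus hω hF' ?_,
    ⟨hi.isometryEquivOnRange⟩⟩
  refine SetLike.coe_injective ?_
  change ⋃ f ∈ g '' F.maps, f '' Set.range i = Set.range i
  ext y
  simp only [Set.mem_iUnion, Set.mem_image, Set.mem_range, exists_prop]
  constructor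
  · rintro ⟨_, ⟨f, hf, rfl⟩, _, ⟨x, rfl⟩, rfl⟩
    exact ⟨f x, ((hg f hf).2 x).symm⟩
  · rintro ⟨x, rfl⟩
    obtain ⟨f, hf, x', rfl⟩ := Set.mem_iUnion₂.1 (hcov.ge (Set.mem_univ x))
    exact ⟨g f, ⟨f, hf, rfl⟩, i x', ⟨x', rfl⟩, (hg f hf).2 x'⟩

end Attractor

/-! ### A common modulus for a finite family. -/

section Modulus

theorem isRakotchModulus_mul {c : ℝ≥0} (hc : c < 1) : IsRakotchModulus (fun t => c * t) where
  mono := fun s t hst => by dsimp only; gcongr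
  add_le := fun s t => (mul_add c s t).le
  le_self := fun t => mul_le_of_le_one_left zero_le hc.le
  exists_le_mul := fun _ _ => ⟨c, hc, fun _ _ => le_rfl⟩

/-- The infimum of the lines through `(a, a)` with slope `c a`, over all `a > 0`. -/
noncomputable def envelope (c : ℝ≥0 → ℝ≥0) (t : ℝ≥0) : ℝ≥0 :=
  ⨅ a : {a : ℝ≥0 // 0 < a}, (c a * t + (1 - c a) * a)

instance : Nonempty {a : ℝ≥0 // 0 < a} := ⟨⟨1, one_pos⟩⟩

theorem envelope_le (c : ℝ≥0 → ℝ≥0) (t : ℝ≥0) {a : ℝ≥0} (ha : 0 < a) :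
    envelope c t ≤ c a * t + (1 - c a) * a :=
  ciInf_le (OrderBot.bddBelow _) (⟨a, ha⟩ : {a : ℝ≥0 // 0 < a})

/-- For subadditivity, given a line for `s` and one for `t`, follow the flatter of the two up to `s
+ t`. For the fractional bound beyond `a`, the line through `(a / 2, a / 2)` has a constant term at
most `(1 - c) * (t / 2)`, giving ratio `(1 + c) / 2` where `c` is its slope. -/
theorem isRakotchModulus_envelope {c : ℝ≥0 → ℝ≥0} (hc : ∀ a, 0 < a → c a < 1) :
    IsRakotchModulus (envelope c) where
  mono s t hst := ciInf_mono (OrderBot.bddBelow _) fun a => by gcongr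
  add_le s t := by
    refine NNReal.le_iInf_add_iInf fun ⟨a, ha⟩ ⟨b, hb⟩ => ?_
    dsimp only
    rcases le_total (c a) (c b) with h | h
    · calc envelope c (s + t) ≤ c a * (s + t) + (1 - c a) * a := envelope_le c _ ha
        _ = c a * s + (1 - c a) * a + c a * t := by ring
        _ ≤ c a * s + (1 - c a) * a + (c b * t + (1 - c b) * b) := by
          gcongr
          exact le_add_of_le_of_nonneg (by gcongr) zero_le
    · calc envelope c (s + t) ≤ c b * (s + t) + (1 - c b) * b := envelope_le c _ hb
        _ = c b * s + (c b * t + (1 - c b) * b) := by ring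
        _ ≤ c a * s + (1 - c a) * a + (c b * t + (1 - c b) * b) := by
          gcongr
          exact le_add_of_le_of_nonneg (by gcongr) zero_le
  le_self t := by
    -- The shift by `ε` covers `t = 0`, where no line is based.
    refine le_of_forall_pos_le_add fun ε hε => ?_
    have ha : 0 < t + ε := add_pos_of_nonneg_of_pos zero_le hε
    calc envelope c t ≤ c (t + ε) * t + (1 - c (t + ε)) * (t + ε) := envelope_le c t ha
      _ ≤ c (t + ε) * (t + ε) + (1 - c (t + ε)) * (t + ε) := by
        gcongr
        exact le_self_add
      _ = t + ε := by rw [← add_mul, add_tsub_cancel_of_le (hc _ ha).le, one_mul]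
  exists_le_mul a ha := by
    have ha2 := half_pos ha
    obtain ⟨d, hd⟩ := exists_add_of_le (hc _ ha2).le
    have hlt := hc _ ha2
    refine ⟨c (a / 2) + d / 2, ?_, fun t ht => ?_⟩
    · rw [hd] at hlt ⊢
      have : 0 < d := pos_of_lt_add_right hlt
      gcongr
      exact half_lt_self this
    · calc envelope c t ≤ c (a / 2) * t + (1 - c (a / 2)) * (a / 2) := envelope_le c t ha2
        _ = c (a / 2) * t + d * (a / 2) := by
          congr 2
          exact tsub_eq_of_eq_add_rev hd
        _ ≤ c (a / 2) * t + d * (t / 2) := by gcongr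
        _ = (c (a / 2) + d / 2) * t := by ring

/-- Lines based at `a < t` are handled by the slope bound; those based at `a ≥ t` lie on or above
the diagonal at `t`. -/
theorem le_envelope {c : ℝ≥0 → ℝ≥0} (hc : ∀ a, 0 < a → c a < 1) {s t : ℝ≥0} (hst : s ≤ t)
    (h : ∀ a, 0 < a → a < t → s ≤ c a * t) : s ≤ envelope c t := by
  refine le_ciInf fun ⟨a, ha⟩ => ?_
  dsimp only
  rcases lt_or_ge a t with hat | hta
  · exact le_add_of_le_of_nonneg (h a ha hat) zero_le
  · calc s ≤ t := hst
      _ = c a * t + (1 - c a) * t := by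
        rw [← add_mul, add_tsub_cancel_of_le (hc _ ha).le, one_mul]
      _ ≤ c a * t + (1 - c a) * a := by gcongr

/-- Stating the bound for all constants close to `1` from below lets a finite family share one
constant by intersecting filter sets. -/
theorem IsRakotchContracting.eventually {X Y : Type*} [MetricSpace X] [MetricSpace Y] {f : X → Y}
    (hf : IsRakotchContracting f) {a : ℝ≥0} (ha : 0 < a) :
    ∀ᶠ c in 𝓝[<] (1 : ℝ≥0), ∀ x x', a < nndist x x' → nndist (f x) (f x') ≤ c * nndist x x' := by
  obtain ⟨φ, hφ, hfφ⟩ := hf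
  obtain ⟨c, hc, h⟩ := hφ a ha
  filter_upwards [Ico_mem_nhdsLT hc] with b hb x x' hx
  refine (hfφ x x').trans ?_
  rw [← div_le_iff₀ (ha.trans hx)]
  exact (h _ hx).trans hb.1

theorem IsBanachContracting.eventually {X Y : Type*} [MetricSpace X] [MetricSpace Y] {f : X → Y}
    (hf : IsBanachContracting f) : ∀ᶠ c in 𝓝[<] (1 : ℝ≥0), LipschitzWith c f := by
  obtain ⟨c, hc, h⟩ := hf
  filter_upwards [Ico_mem_nhdsLT hc] with b hb
  exact h.weaken hb.1

instance : (𝓝[<] (1 : ℝ≥0)).NeBot := nhdsLT_neBot_of_exists_lt ⟨0, one_pos⟩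

theorem FunctionSystem.exists_isRakotchModulus {X : Type*} [MetricSpace X] (F : FunctionSystem X)
    (hF : ∀ f ∈ F.maps, IsRakotchContracting f) :
    ∃ ω, IsRakotchModulus ω ∧ ∀ f ∈ F.maps, IsPhiContracting ω f := by
  have hex : ∀ a : ℝ≥0, 0 < a → ∃ c < (1 : ℝ≥0), ∀ f ∈ F.maps, ∀ x x', a < nndist x x' →
      nndist (f x) (f x') ≤ c * nndist x x' := fun a ha =>
    (eventually_mem_nhdsWithin.and
      ((eventually_all_finite F.finite).2 fun f hf => (hF f hf).eventually ha)).exists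
  choose! c hc hcF using hex
  refine ⟨envelope c, isRakotchModulus_envelope hc, fun f hf x x' => le_envelope hc ?_ ?_⟩
  · rcases eq_or_ne x x' with rfl | hne
    · simp
    -- The bounds need a threshold strictly below the distance; half of it serves.
    · have hpos : 0 < nndist x x' := pos_iff_ne_zero.2 (nndist_eq_zero.not.2 hne)
      have hhalf := half_pos hpos
      exact (hcF _ hhalf f hf x x' (half_lt_self hpos)).trans
        (mul_le_of_le_one_left zero_le (hc _ hhalf).le)
  · exact fun a ha => hcF a ha f hf x x'

theorem FunctionSystem.exists_lipschitzWith {X : Type*} [MetricSpace X] (F : FunctionSystem X)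
    (hF : ∀ f ∈ F.maps, IsBanachContracting f) : ∃ c < 1, ∀ f ∈ F.maps, LipschitzWith c f :=
  (eventually_mem_nhdsWithin.and
    ((eventually_all_finite F.finite).2 fun f hf => (hF f hf).eventually)).exists

end Modulus

theorem theorem4 {U : Type*} [MetricSpace U] (hU : IsUrysohnSpace U)
    {X : Type*} [MetricSpace X] :
    (IsRakotchFractal X →
      ∃ F : FunctionSystem U, (∀ f ∈ F.maps, IsRakotchContracting f) ∧
        ∃ A : NonemptyCompacts U, F.IsAttractor A ∧ Nonempty (X ≃ᵢ A)) ∧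
    (IsBanachFractal X →
      ∃ F : FunctionSystem U, (∀ f ∈ F.maps, IsBanachContracting f) ∧
        ∃ A : NonemptyCompacts U, F.IsAttractor A ∧ Nonempty (X ≃ᵢ A)) := by
  constructor
  · rintro ⟨_, _, F, hF, hcov⟩
    obtain ⟨ω, hω, hFω⟩ := F.exists_isRakotchModulus hF
    obtain ⟨F', hF', hA⟩ := hU.exists_isAttractor hω hFω hcov
    exact ⟨F', fun f hf => hω.isRakotchContracting (hF' f hf), hA⟩
  · rintro ⟨_, _, F, hF, hcov⟩
    obtain ⟨c, hc, hFc⟩ := F.exists_lipschitzWith hF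
    obtain ⟨F', hF', hA⟩ := hU.exists_isAttractor (isRakotchModulus_mul hc)
      (fun f hf x x' => (hFc f hf).nndist_le x x') hcov
    exact ⟨F', fun f hf => ⟨c, hc, LipschitzWith.of_dist_le_mul fun x y => by
      exact_mod_cast hF' f hf x y⟩, hA⟩
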